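/- Let $n\ge 1$ and let $\mathcal A_n^*$ be the free monoid of words in the totally ordered letters $a_1<\dots<a_n$. Let $\equiv_{\mathrm{plc}}$ be the Knuth (plactic) congruence on $\mathcal A_n^*$, that is, the congruence generated by the Knuth relations $$a\,c\,b = c\,a\,b \quad (a\le b<c), \qquad\qquad b\,a\,c = b\,c\,a \quad (a<b\le c),$$ for letters $a,b,c$, and let $\mathcal P_n=\mathcal A_n^*/_{\equiv_{\mathrm{plc}}}$ be the plactic monoid of rank $n$. The co-mirror of the letter $a_\ell$ is the word $$a'_\ell = a_n a_{n-1}\cdots a_{n-\ell+2}\,a_{n-\ell}\cdots a_1$$ (the decreasing word $a_n\cdots a_1$ with the letter $a_{n-\ell+1}$ left out), and the co-mirror of a word $w=a_{\ell_1}\cdots a_{\ell_m}$ is $w'=a'_{\ell_1}\cdots a'_{\ell_m}$. Words $u,v$ are called co-plactic equivalent, $u\equiv^{\mathrm{co}}_{\mathrm{plc}}v$, if $u'\equiv_{\mathrm{plc}}v'$. Then: 1. $a'_1<a'_2<\dots<a'_n$ in the lexicographic order on $\mathcal A_n^*$, and, ordered in this way, these words satisfy the Knuth relations in $\mathcal P_n$: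 $a'_p a'_r a'_q = a'_r a'_p a'_q$ for $p\le q<r$, and $a'_q a'_p a'_r = a'_q a'_r a'_p$ for $p<q\le r$. 2. For all $u,v\in\mathcal A_n^*$, if $u\equiv_{\mathrm{plc}}v$, then $u\equiv^{\mathrm{co}}_{\mathrm{plc}}v$. 3. Let $\partial_1(\mathcal P_n)\subseteq\mathcal P_n$ be the submonoid generated by the classes of $a'_1,\dots,a'_n$. Then $w\mapsto w'$ induces a surjective monoid homomorphism $\partial_1:\mathcal P_n\to\partial_1(\mathcal P_n)$, and if $n\ge 2$, it is an isomorphism of monoids. -/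

import Mathlib

/-- The elementary Knuth relations on words over a totally ordered alphabet `α`:
`a c b = c a b` for `a ≤ b < c` and `b a c = b c a` for `a < b ≤ c`. -/
inductive KnuthRel {α : Type*} [LinearOrder α] : FreeMonoid α → FreeMonoid α → Prop
  | kn1 (a b c : α) (hab : a ≤ b) (hbc : b < c) :
      KnuthRel (FreeMonoid.of a * FreeMonoid.of c * FreeMonoid.of b)
        (FreeMonoid.of c * FreeMonoid.of a * FreeMonoid.of b)
  | kn2 (a b c : α) (hab : a < b) (hbc : b ≤ c) :
      KnuthRel (FreeMonoid.of b * FreeMonoid.of a * FreeMonoid.of c)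
        (FreeMonoid.of b * FreeMonoid.of c * FreeMonoid.of a)

/-- A family `x` of elements of a monoid, ordered by its index set, satisfies the Knuth
relations. -/
def SatisfiesKnuthRelations {ι M : Type*} [LinearOrder ι] [Monoid M] (x : ι → M) : Prop :=
  (∀ p q r : ι, p ≤ q → q < r → x p * x r * x q = x r * x p * x q) ∧
    (∀ p q r : ι, p < q → q ≤ r → x q * x p * x r = x q * x r * x p)

/-- The Knuth (plactic) congruence on words in the letters `a_1 < ⋯ < a_n`; the letter
`a_{i+1}` is `i : Fin n`. -/
def placticCon (n : ℕ) : Con (FreeMonoid (Fin n)) :=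
  conGen KnuthRel

/-- The plactic monoid of rank `n`. -/
abbrev PlacticMonoid (n : ℕ) : Type :=
  (placticCon n).Quotient

/-- The class of a word in the plactic monoid. -/
def placticClass (n : ℕ) : FreeMonoid (Fin n) →* PlacticMonoid n :=
  (placticCon n).mk'

/-- The co-mirror of a letter: the decreasing word `a_n a_{n-1} ⋯ a_1` with one letter left out.
For `a_ℓ` the missing letter is `a_{n-ℓ+1}`, i.e. `i.rev` for `i = ℓ - 1`. -/
def coMirrorLetter {n : ℕ} (i : Fin n) : FreeMonoid (Fin n) :=
  FreeMonoid.ofList ((List.finRange n).reverse.filter (fun j => j ≠ i.rev))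

/-- The co-mirror of a word, obtained letter by letter (the empty word goes to itself). -/
def coMirror (n : ℕ) : FreeMonoid (Fin n) →* FreeMonoid (Fin n) :=
  FreeMonoid.lift coMirrorLetter

/-- The co-plactic equivalence: two words are equivalent if and only if their co-mirrors are
Knuth equivalent. -/
def CoPlacticEquiv (n : ℕ) (u v : FreeMonoid (Fin n)) : Prop :=
  placticCon n (coMirror n u) (coMirror n v)

/-- The submonoid of the plactic monoid generated by the co-mirrors of the generators. -/
def coMirrorSubmonoid (n : ℕ) : Submonoid (PlacticMonoid n) :=
  Submonoid.closure (Set.range fun i : Fin n => placticClass n (coMirrorLetter i))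

/-! Knuth equivalence is compatible with the type A crystal structure on words: for neighbouring
letters `a ⋖ b`, equivalent words have the same numbers of unmatched letters and stay equivalent
under `raise` and `lower` (`CovBy.crystalEquiv`). Co-mirroring respects this structure up to
reversal of the alphabet: the pair `(a, b)` acts on `w` as `(b.rev, a.rev)` acts on its co-mirror
(`mirror_crystal`). Raising both words in parallel ends at highest weight (Yamanouchi) words, and
lowering undoes each step, so both implications between Knuth and co-plactic equivalence need
checking only there (`raise_induction`).

Highest weight words with the same content are Knuth equivalent (`IsYamanouchi.knuthEquiv`), since
each is equivalent to a product of columns `k ⋯ 1` and columns commute. The content of a word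
determines that of its co-mirror, and conversely if `2 ≤ n`; for `n = 1` all co-mirrors are empty.
-/

namespace Crystal
variable {α : Type*} [LinearOrder α]

/-! ### Knuth equivalence on lists -/

/-- Knuth equivalence of words, written as lists. -/
def KnuthEquiv (u v : List α) : Prop :=
  conGen (KnuthRel (α := α)) (FreeMonoid.ofList u) (FreeMonoid.ofList v)

namespace KnuthEquiv

theorem refl (u : List α) : KnuthEquiv u u := (conGen KnuthRel).refl _

theorem of_eq {u v : List α} (h : u = v) : KnuthEquiv u v := h ▸ refl u

theorem symm {u v : List α} (h : KnuthEquiv u v) : KnuthEquiv v u := (conGen KnuthRel).symm h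

theorem trans {u v w : List α} (h : KnuthEquiv u v) (h' : KnuthEquiv v w) : KnuthEquiv u w :=
  (conGen KnuthRel).trans h h'

theorem append {u v w z : List α} (h : KnuthEquiv u v) (h' : KnuthEquiv w z) :
    KnuthEquiv (u ++ w) (v ++ z) :=
  (conGen KnuthRel).mul h h'

theorem cons (x : α) {u v : List α} (h : KnuthEquiv u v) : KnuthEquiv (x :: u) (x :: v) :=
  append (refl [x]) h

theorem kn1 {a b c : α} (hab : a ≤ b) (hbc : b < c) : KnuthEquiv [a, c, b] [c, a, b] :=
  ConGen.Rel.of _ _ (KnuthRel.kn1 a b c hab hbc)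

theorem kn2 {a b c : α} (hab : a < b) (hbc : b ≤ c) : KnuthEquiv [b, a, c] [b, c, a] :=
  ConGen.Rel.of _ _ (KnuthRel.kn2 a b c hab hbc)

/-- Induction over Knuth equivalence. -/
theorem induction {P : List α → List α → Prop}
    (hkn1 : ∀ a b c : α, a ≤ b → b < c → P [a, c, b] [c, a, b])
    (hkn2 : ∀ a b c : α, a < b → b ≤ c → P [b, a, c] [b, c, a])
    (hrefl : ∀ u, P u u) (hsymm : ∀ u v, P u v → P v u)
    (htrans : ∀ u v w, P u v → P v w → P u w)
    (happ : ∀ u v w z, P u v → P w z → P (u ++ w) (v ++ z))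
    {u v : List α} (h : KnuthEquiv u v) : P u v := by
  have key : ∀ x y : FreeMonoid α, ConGen.Rel KnuthRel x y → P x.toList y.toList := by
    intro x y h
    induction h with
    | of x y h =>
      cases h with
      | kn1 a b c h1 h2 => exact hkn1 a b c h1 h2
      | kn2 a b c h1 h2 => exact hkn2 a b c h1 h2
    | refl x => exact hrefl _
    | symm _ ih => exact hsymm _ _ ih
    | trans _ _ ih1 ih2 => exact htrans _ _ _ ih1 ih2
    | mul _ _ ih1 ih2 => exact happ _ _ _ _ ih1 ih2
  exact key _ _ h

theorem perm {u v : List α} (h : KnuthEquiv u v) : u.Perm v :=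
  KnuthEquiv.induction (P := List.Perm) (fun _ _ _ _ _ => List.Perm.swap _ _ _)
    (fun _ _ _ _ _ => (List.Perm.swap _ _ _).cons _) List.Perm.refl (fun _ _ h => h.symm)
    (fun _ _ _ h h' => h.trans h') (fun _ _ _ _ h h' => h.append h') h

end KnuthEquiv

/-! ### Bracketing and crystal operators on words -/

/-- `(phi, eps)` for the pair of letters `a < b`: the numbers of letters `a`, resp. `b`, that
remain unmatched when every `b` is matched with a later `a` as a pair of brackets. -/
def strings (a b : α) : List α → ℕ × ℕ
  | [] => (0, 0)
  | x :: w =>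
    ((if x = a then 1 else 0) + ((strings a b w).1 - if x = b then 1 else 0),
      (strings a b w).2 + ((if x = b then 1 else 0) - (strings a b w).1))

/-- The number of unmatched letters `a`. -/
def phi (a b : α) (w : List α) : ℕ := (strings a b w).1

/-- The number of unmatched letters `b`. -/
def eps (a b : α) (w : List α) : ℕ := (strings a b w).2

/-- The raising operator: turn the leftmost unmatched `b`, if any, into `a`. -/
def raise (a b : α) : List α → List α
  | [] => []
  | x :: w => if phi a b w < (if x = b then 1 else 0) then a :: w else x :: raise a b w

/-- The lowering operator: turn the rightmost unmatched `a`, if any, into `b`. -/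
def lower (a b : α) : List α → List α
  | [] => []
  | x :: w => if (if x = b then 1 else 0) < phi a b w then x :: lower a b w
      else (if x = a then b else x) :: w

variable (a b : α)

@[simp] theorem phi_nil : phi a b [] = 0 := rfl
@[simp] theorem eps_nil : eps a b [] = 0 := rfl
@[simp] theorem raise_nil : raise a b [] = [] := rfl
@[simp] theorem lower_nil : lower a b [] = [] := rfl

theorem phi_cons (x : α) (w : List α) :
    phi a b (x :: w) = (if x = a then 1 else 0) + (phi a b w - if x = b then 1 else 0) := rfl

theorem eps_cons (x : α) (w : List α) :
    eps a b (x :: w) = eps a b w + ((if x = b then 1 else 0) - phi a b w) := rfl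

theorem raise_cons (x : α) (w : List α) : raise a b (x :: w) =
    if phi a b w < (if x = b then 1 else 0) then a :: w else x :: raise a b w := rfl

theorem lower_cons (x : α) (w : List α) : lower a b (x :: w) =
    if (if x = b then 1 else 0) < phi a b w then x :: lower a b w
      else (if x = a then b else x) :: w := rfl

variable {a b}

/-- Unmatched letters `b` of `u` cancel against unmatched letters `a` of `v`; truncated subtraction
counts what survives. -/
theorem strings_append (hab : a ≠ b) (u v : List α) :
    phi a b (u ++ v) = phi a b u + (phi a b v - eps a b u) ∧
      eps a b (u ++ v) = eps a b v + (eps a b u - phi a b v) := by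
  induction u with
  | nil => simp
  | cons x u ih =>
    obtain ⟨h1, h2⟩ := ih
    simp only [List.cons_append, phi_cons, eps_cons, h1, h2]
    by_cases hb : x = b
    · simp only [hb, hab.symm, if_true, if_false]; omega
    · simp only [hb, if_false]; split_ifs <;> omega

theorem phi_append (hab : a ≠ b) (u v : List α) :
    phi a b (u ++ v) = phi a b u + (phi a b v - eps a b u) := (strings_append hab u v).1

theorem eps_append (hab : a ≠ b) (u v : List α) :
    eps a b (u ++ v) = eps a b v + (eps a b u - phi a b v) := (strings_append hab u v).2

/-- Tensor product rule: the leftmost unmatched `b` lies in `u` exactly when `v` has too few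
unmatched letters `a` to absorb all those of `u`. -/
theorem raise_append (hab : a ≠ b) (u v : List α) :
    raise a b (u ++ v) =
      if phi a b v < eps a b u then raise a b u ++ v else u ++ raise a b v := by
  induction u with
  | nil => simp
  | cons x u ih =>
    simp only [List.cons_append, raise_cons, phi_append hab, eps_cons, ih]
    by_cases hb : x = b <;> simp only [hb, if_true, if_false]
    all_goals split_ifs <;> first | rfl | omega

theorem lower_eq_self {w : List α} (h : phi a b w = 0) : lower a b w = w := by
  cases w with
  | nil => rfl
  | cons x w =>
    rw [phi_cons] at h
    rw [lower_cons]
    split_ifs at h ⊢ <;> first | rfl | omega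

theorem lower_append (hab : a ≠ b) (u v : List α) :
    lower a b (u ++ v) =
      if eps a b u < phi a b v then u ++ lower a b v else lower a b u ++ v := by
  induction u with
  | nil =>
    by_cases h : 0 < phi a b v
    · simp [h]
    · simp [lower_eq_self (Nat.eq_zero_of_not_pos h)]
  | cons x u ih =>
    simp only [List.cons_append, lower_cons, phi_append hab, eps_cons, ih]
    by_cases hb : x = b <;> simp only [hb, if_true, if_false]
    all_goals split_ifs <;> first | rfl | omega

/-! ### Compatibility of Knuth equivalence with the crystal operators -/

/-- Words that are Knuth equivalent and stay so under the crystal operators. -/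
structure CrystalEquiv (a b : α) (u v : List α) : Prop where
  equiv : KnuthEquiv u v
  phi_eq : phi a b u = phi a b v
  eps_eq : eps a b u = eps a b v
  raise : KnuthEquiv (raise a b u) (raise a b v)
  lower : KnuthEquiv (lower a b u) (lower a b v)

theorem CrystalEquiv.append (hab : a ≠ b) {u v w z : List α} (h : CrystalEquiv a b u v)
    (h' : CrystalEquiv a b w z) : CrystalEquiv a b (u ++ w) (v ++ z) where
  equiv := h.equiv.append h'.equiv
  phi_eq := by rw [phi_append hab, phi_append hab, h.phi_eq, h.eps_eq, h'.phi_eq]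
  eps_eq := by rw [eps_append hab, eps_append hab, h.eps_eq, h'.phi_eq, h'.eps_eq]
  raise := by
    rw [raise_append hab, raise_append hab, h.eps_eq, h'.phi_eq]
    split_ifs
    · exact h.raise.append h'.equiv
    · exact h.equiv.append h'.raise
  lower := by
    rw [lower_append hab, lower_append hab, h.eps_eq, h'.phi_eq]
    split_ifs
    · exact h.equiv.append h'.lower
    · exact h.lower.append h'.equiv

theorem _root_.CovBy.cases (hab : a ⋖ b) (x : α) : x = a ∨ x = b ∨ (x < a ∧ x ≠ a ∧ x ≠ b) ∨
    (b < x ∧ x ≠ a ∧ x ≠ b) := by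
  rcases lt_trichotomy x a with h | h | h
  · exact Or.inr (Or.inr (Or.inl ⟨h, h.ne, (h.trans hab.lt).ne⟩))
  · exact Or.inl h
  · rcases eq_or_lt_of_le (hab.ge_of_gt h) with h' | h'
    · exact Or.inr (Or.inl h'.symm)
    · exact Or.inr (Or.inr (Or.inr ⟨h', (hab.lt.trans h').ne', h'.ne'⟩))

-- As no letter lies strictly between `a` and `b`, finitely many configurations remain. An operator
-- can turn one kind of Knuth relation into the inverse of the other: for `p = q = a` and `r = b`,
-- lowering gives `[b, b, a]` and `[b, a, b]`.
set_option linter.unusedSimpArgs false in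
set_option maxHeartbeats 2000000 in
theorem crystalEquiv_kn1 (hab : a ⋖ b) {p q r : α} (hpq : p ≤ q) (hqr : q < r) :
    CrystalEquiv a b [p, r, q] [r, p, q] := by
  have hlt := hab.lt
  rcases hab.cases p with hp | hp | ⟨hp, hpa, hpb⟩ | ⟨hp, hpa, hpb⟩ <;>
    rcases hab.cases q with hq | hq | ⟨hq, hqa, hqb⟩ | ⟨hq, hqa, hqb⟩ <;>
    rcases hab.cases r with hr | hr | ⟨hr, hra, hrb⟩ | ⟨hr, hra, hrb⟩ <;>
    first
    | (exfalso; order)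
    | (refine ⟨KnuthEquiv.kn1 hpq hqr, ?_, ?_, ?_, ?_⟩ <;> subst_vars <;>
        simp only [phi_cons, eps_cons, raise_cons, lower_cons, phi_nil, eps_nil, raise_nil,
          lower_nil, hlt.ne, hlt.ne', *, if_true, if_false] <;>
        norm_num <;>
        first
        | exact KnuthEquiv.refl _
        | (refine KnuthEquiv.kn1 ?_ ?_ <;> order)
        | (refine KnuthEquiv.kn2 ?_ ?_ <;> order)
        | (refine (KnuthEquiv.kn2 ?_ ?_).symm <;> order))

set_option linter.unusedSimpArgs false in
set_option maxHeartbeats 2000000 in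
theorem crystalEquiv_kn2 (hab : a ⋖ b) {p q r : α} (hpq : p < q) (hqr : q ≤ r) :
    CrystalEquiv a b [q, p, r] [q, r, p] := by
  have hlt := hab.lt
  rcases hab.cases p with hp | hp | ⟨hp, hpa, hpb⟩ | ⟨hp, hpa, hpb⟩ <;>
    rcases hab.cases q with hq | hq | ⟨hq, hqa, hqb⟩ | ⟨hq, hqa, hqb⟩ <;>
    rcases hab.cases r with hr | hr | ⟨hr, hra, hrb⟩ | ⟨hr, hra, hrb⟩ <;>
    first
    | (exfalso; order)
    | (refine ⟨KnuthEquiv.kn2 hpq hqr, ?_, ?_, ?_, ?_⟩ <;> subst_vars <;>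
        simp only [phi_cons, eps_cons, raise_cons, lower_cons, phi_nil, eps_nil, raise_nil,
          lower_nil, hlt.ne, hlt.ne', *, if_true, if_false] <;>
        norm_num <;>
        first
        | exact KnuthEquiv.refl _
        | (refine KnuthEquiv.kn1 ?_ ?_ <;> order)
        | (refine KnuthEquiv.kn2 ?_ ?_ <;> order)
        | (refine (KnuthEquiv.kn1 ?_ ?_).symm <;> order))

theorem _root_.CovBy.crystalEquiv (hab : a ⋖ b) {u v : List α} (h : KnuthEquiv u v) :
    CrystalEquiv a b u v :=
  KnuthEquiv.induction (P := CrystalEquiv a b)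
    (fun _ _ _ => crystalEquiv_kn1 hab) (fun _ _ _ => crystalEquiv_kn2 hab)
    (fun u => ⟨.refl u, rfl, rfl, .refl _, .refl _⟩)
    (fun _ _ h => ⟨h.equiv.symm, h.phi_eq.symm, h.eps_eq.symm, h.raise.symm, h.lower.symm⟩)
    (fun _ _ _ h h' => ⟨h.equiv.trans h'.equiv, h.phi_eq.trans h'.phi_eq,
      h.eps_eq.trans h'.eps_eq, h.raise.trans h'.raise, h.lower.trans h'.lower⟩)
    (fun _ _ _ _ h h' => h.append hab.lt.ne h') h

/-! ### Lowering inverts raising -/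

theorem raise_eq_self {w : List α} (h : eps a b w = 0) : raise a b w = w := by
  induction w with
  | nil => rfl
  | cons x w ih =>
    rw [eps_cons] at h
    rw [raise_cons, if_neg (by omega), ih (by omega)]

theorem phi_raise (hab : a ≠ b) {w : List α} (h : 0 < eps a b w) :
    phi a b (raise a b w) = phi a b w + 1 := by
  induction w with
  | nil => simp at h
  | cons x w ih =>
    rw [eps_cons] at h
    rw [raise_cons]
    by_cases hb : x = b
    · simp only [hb, if_true] at h ⊢
      split_ifs with h'
      · simp [phi_cons, hab, hab.symm]; omega
      · simp only [phi_cons, hab.symm, if_true, if_false, ih (by omega)]; omega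
    · simp only [hb, if_false] at h ⊢
      simp only [phi_cons, hb, if_false, Nat.not_lt_zero, ih (by omega)]; omega

/-- The unmatched letters of `w` read `a ⋯ a b ⋯ b`, so the leftmost unmatched `b` becomes the
rightmost unmatched `a`. -/
theorem lower_raise (hab : a ≠ b) {w : List α} (h : 0 < eps a b w) :
    lower a b (raise a b w) = w := by
  induction w with
  | nil => simp at h
  | cons x w ih =>
    rw [eps_cons] at h
    rw [raise_cons]
    by_cases hb : x = b
    · simp only [hb, if_true] at h ⊢
      split_ifs with h'
      · simp [lower_cons, hab]; omega
      · rw [lower_cons, phi_raise hab (by omega), ih (by omega)]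
        simp; omega
    · simp only [hb, if_false] at h ⊢
      rw [if_neg (by omega), lower_cons, phi_raise hab (by omega), ih (by omega)]
      simp [hb]

theorem phi_add_count (w : List α) :
    phi a b w + w.count b = eps a b w + w.count a := by
  induction w with
  | nil => simp
  | cons x w ih =>
    simp only [phi_cons, eps_cons, List.count_cons, beq_iff_eq]
    split_ifs <;> omega

/-! ### Highest weight words -/

/-- Highest weight words: no raising operator applies. -/
def IsYamanouchi (w : List α) : Prop := ∀ a b : α, a ⋖ b → eps a b w = 0

theorem KnuthEquiv.isYamanouchi {u v : List α} (h : KnuthEquiv u v) (hu : IsYamanouchi u) :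
    IsYamanouchi v := fun a b hab => (hab.crystalEquiv h).eps_eq ▸ hu a b hab

theorem IsYamanouchi.tail {x : α} {w : List α} (h : IsYamanouchi (x :: w)) : IsYamanouchi w :=
  fun a b hab => by have := h a b hab; rw [eps_cons] at this; omega

theorem exists_eq_append_of_covBy (hab : a ⋖ b) {l : List α} (hl : l.Pairwise (· > ·))
    (ha : a ∈ l) (hb : b ∈ l) : ∃ s t, l = s ++ b :: a :: t := by
  obtain ⟨s, t, rfl⟩ := List.append_of_mem hb
  rw [List.pairwise_append, List.pairwise_cons] at hl
  obtain ⟨-, ⟨hbt, ht⟩, hs⟩ := hl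
  have hat : a ∈ t := by
    rcases List.mem_append.1 ha with h | h
    · exact absurd (hs a h b (by simp)) hab.lt.not_gt
    · exact (List.mem_cons.1 h).resolve_left hab.lt.ne
  obtain _ | ⟨c, t⟩ := t
  · simp at hat
  · rcases List.mem_cons.1 hat with rfl | h
    · exact ⟨s, t, rfl⟩
    · exact absurd (hab.2 ((List.pairwise_cons.1 ht).1 a h)) (not_not.2 (hbt c (by simp)))

theorem strings_of_not_mem {l : List α} (ha : a ∉ l) (hb : b ∉ l) :
    phi a b l = 0 ∧ eps a b l = 0 := by
  induction l with
  | nil => simp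
  | cons x l ih =>
    simp only [List.mem_cons, not_or] at ha hb
    simp [phi_cons, eps_cons, ih ha.2 hb.2, Ne.symm ha.1, Ne.symm hb.1]

/-! ### Commutation with decreasing words -/

/-- A letter moves to the right through larger letters in decreasing order. -/
theorem KnuthEquiv.move_gt {x : α} {l : List α} (hl : l.Pairwise (· > ·)) (hx : ∀ y ∈ l, x < y) :
    KnuthEquiv (x :: (l ++ [x])) (l ++ [x, x]) := by
  induction l with
  | nil => exact .refl _
  | cons c l ih =>
    rw [List.pairwise_cons] at hl
    simp only [List.forall_mem_cons] at hx
    refine KnuthEquiv.trans ?_ ((ih hl.2 hx.2).cons c)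
    -- The third letter of the Knuth relation is the next letter of the column, or the closing `x`
    -- once the column is used up.
    cases l with
    | nil => exact kn1 le_rfl hx.1
    | cons d l => exact (kn1 (hx.2 d (by simp)).le (hl.1 d (by simp))).append (.refl (l ++ [x]))

/-- A letter moves to the right through smaller letters in decreasing order. -/
theorem KnuthEquiv.move_lt {x y : α} {l : List α} (hl : (y :: l).Pairwise (· > ·)) (hx : y ≤ x) :
    KnuthEquiv (y :: x :: l) (y :: (l ++ [x])) := by
  induction l generalizing y with
  | nil => exact .refl _
  | cons c l ih =>
    rw [List.pairwise_cons] at hl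
    have hc : c < y := hl.1 c (by simp)
    exact ((kn2 hc hx).symm.append (.refl l)).trans ((ih hl.2 (hc.le.trans hx)).cons y)

/-- With `l = s ++ x :: t`, the front `x` crosses `s` thanks to the `x` behind it; one of the two
copies then crosses `t` thanks to the other in front. -/
theorem KnuthEquiv.cons_comm {x : α} {l : List α} (hl : l.Pairwise (· > ·)) (hx : x ∈ l) :
    KnuthEquiv (x :: l) (l ++ [x]) := by
  obtain ⟨s, t, rfl⟩ := List.append_of_mem hx
  rw [List.pairwise_append] at hl
  have h1 := (move_gt hl.1 (fun y hy => hl.2.2 y hy x (by simp))).append (.refl t)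
  have h2 := (KnuthEquiv.refl s).append (move_lt hl.2.1 le_rfl)
  simp only [List.cons_append, List.append_assoc, List.nil_append] at h1 h2 ⊢
  exact h1.trans h2

theorem KnuthEquiv.append_comm {u l : List α} (hl : l.Pairwise (· > ·)) (hu : u ⊆ l) :
    KnuthEquiv (u ++ l) (l ++ u) := by
  induction u with
  | nil => exact .of_eq (by simp)
  | cons x u ih =>
    have h1 := (ih (fun y hy => hu (by simp [hy]))).cons x
    have h2 := (cons_comm hl (hu (by simp : x ∈ x :: u))).append (.refl u)
    simp only [List.cons_append, List.append_assoc, List.nil_append] at h1 h2 ⊢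
    exact h1.trans h2

/-! ### Columns as normal forms of highest weight words -/

section Columns
variable {n : ℕ}

/-- The decreasing word in all letters. -/
def fullColumn (n : ℕ) : List (Fin n) := (List.finRange n).reverse

theorem pairwise_fullColumn (n : ℕ) : (fullColumn n).Pairwise (· > ·) :=
  List.pairwise_reverse.2 (List.pairwise_lt_finRange n)

theorem mem_fullColumn (x : Fin n) : x ∈ fullColumn n := by simp [fullColumn]

theorem exists_fullColumn_eq {x y : Fin n} (h : x ⋖ y) :
    ∃ s t, fullColumn n = s ++ y :: x :: t :=
  exists_eq_append_of_covBy h (pairwise_fullColumn n) (mem_fullColumn x) (mem_fullColumn y)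

theorem exists_fullColumn_eq_append (x : Fin n) :
    ∃ s t, fullColumn n = s ++ x :: t ∧ (∀ y ∈ s, x < y) ∧ ∀ y ∈ t, y < x := by
  obtain ⟨s, t, h⟩ := List.append_of_mem (mem_fullColumn x)
  have hp := pairwise_fullColumn n
  rw [h, List.pairwise_append, List.pairwise_cons] at hp
  exact ⟨s, t, h, fun y hy => hp.2.2 y hy x (by simp), fun y hy => hp.2.1.1 y hy⟩

/-- The decreasing word in the letters up to `k`. -/
def column (k : Fin n) : List (Fin n) := (fullColumn n).filter (· ≤ k)

theorem column_zero {x : Fin n} (hx : x.val = 0) : column x = [x] := by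
  obtain ⟨s, t, h, hs, ht⟩ := exists_fullColumn_eq_append x
  have ht' : t = [] := List.eq_nil_iff_forall_not_mem.2 fun y hy => by
    have := ht y hy; rw [Fin.lt_def] at this; omega
  rw [column, h, ht', List.filter_append, List.filter_eq_nil_iff.2 (by simpa using hs)]
  simp

theorem column_succ {x y : Fin n} (h : y ⋖ x) : column x = x :: column y := by
  obtain ⟨s, t, hst⟩ := exists_fullColumn_eq h
  have hp := pairwise_fullColumn n
  rw [hst, List.pairwise_append, List.pairwise_cons, List.pairwise_cons] at hp
  obtain ⟨-, ⟨hx, hy, -⟩, hs⟩ := hp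
  have h1 : ∀ z ∈ s, x < z := fun z hz => hs z hz x (by simp)
  have h2 : ∀ z ∈ t, z ≤ y := fun z hz => (hy z hz).le
  have h5 : s.filter (· ≤ y) = [] :=
    List.filter_eq_nil_iff.2 (by simpa using fun z hz => h.lt.trans (h1 z hz))
  have h6 : s.filter (· ≤ x) = [] := List.filter_eq_nil_iff.2 (by simpa using h1)
  have h3 : t.filter (· ≤ y) = t := List.filter_eq_self.2 (by simpa using h2)
  have h4 : t.filter (· ≤ x) = t :=
    List.filter_eq_self.2 (by simpa using fun z hz => (h2 z hz).trans h.le)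
  simp [column, hst, h.lt, h.le, h3, h4, h5, h6]

theorem column_comm (j k : Fin n) :
    KnuthEquiv (column j ++ column k) (column k ++ column j) := by
  have key : ∀ j k : Fin n, j ≤ k →
      KnuthEquiv (column j ++ column k) (column k ++ column j) := fun j k h =>
    KnuthEquiv.append_comm ((pairwise_fullColumn n).filter _) fun x hx => by
      simp only [column, List.mem_filter, decide_eq_true_eq] at hx ⊢
      exact ⟨hx.1, hx.2.trans h⟩
  rcases le_total j k with h | h
  · exact key j k h
  · exact (key k j h).symm

/-- The concatenation of a list of columns. -/
def columns (l : List (Fin n)) : List (Fin n) := l.flatMap column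

theorem columns_perm {l l' : List (Fin n)} (h : l.Perm l') :
    KnuthEquiv (columns l) (columns l') := by
  induction h with
  | nil => exact .refl _
  | cons x _ ih => exact (KnuthEquiv.refl (column x)).append ih
  | swap x y l =>
    have := (column_comm y x).append (.refl (columns l))
    simpa [columns] using this
  | trans _ _ h h' => exact h.trans h'

theorem count_column (x k : Fin n) : (column k).count x = if x ≤ k then 1 else 0 := by
  have h : (fullColumn n).count x = 1 := by
    rw [fullColumn, List.count_reverse]; simp
  split_ifs with hx
  · rw [column, List.count_filter (by simpa using hx), h]
  · exact List.count_eq_zero.2 (by simp [column, hx])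

theorem count_columns (x : Fin n) (l : List (Fin n)) :
    (columns l).count x = l.countP (x ≤ ·) := by
  induction l with
  | nil => rfl
  | cons k l ih =>
    have : columns (k :: l) = column k ++ columns l := rfl
    rw [this, List.count_append, ih, count_column, List.countP_cons]
    simp [add_comm]

theorem countP_covBy {x y : Fin n} (h : x ⋖ y) (l : List (Fin n)) :
    l.countP (x ≤ ·) = l.count x + l.countP (y ≤ ·) := by
  induction l with
  | nil => rfl
  | cons k l ih =>
    rw [List.countP_cons, List.countP_cons, List.count_cons, ih]
    simp only [decide_eq_true_eq, beq_iff_eq]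
    have h1 := h.lt
    rcases h.cases k with rfl | rfl | ⟨h2, h3, h4⟩ | ⟨h2, h3, h4⟩
    · simp [h1.not_ge]; omega
    · simp [h1.le, h1.ne']; omega
    · simp [h2.not_ge, h3, (h2.trans h1).not_ge]
    · simp [h2.le, h3, (h1.trans h2).le]; omega

theorem exists_covBy_right (x : Fin n) : (∀ y, y ≤ x) ∨ ∃ y, x ⋖ y := by
  by_cases h : x.val + 1 < n
  · exact Or.inr ⟨⟨x + 1, h⟩, by
      constructor
      · rw [Fin.lt_def]; simp
      · intro z h1 h2; rw [Fin.lt_def] at h1 h2; simp at h2; omega⟩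
  · exact Or.inl fun y => by rw [Fin.le_def]; omega

theorem exists_covBy_left (x : Fin n) : x.val = 0 ∨ ∃ y, y ⋖ x := by
  by_cases h : x.val = 0
  · exact Or.inl h
  · exact Or.inr ⟨⟨x - 1, by omega⟩, by
      constructor
      · rw [Fin.lt_def]; simp; omega
      · intro z h1 h2; rw [Fin.lt_def] at h1 h2; simp at h1; omega⟩

/-- The letter `x` occurs once in each column with top at least `x`, so differences of consecutive
letter counts recover the multiplicities of the tops. -/
theorem perm_of_columns_perm {l l' : List (Fin n)} (h : (columns l).Perm (columns l')) :
    l.Perm l' := by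
  rw [List.perm_iff_count] at h ⊢
  simp only [count_columns] at h
  intro x
  rcases exists_covBy_right x with hx | ⟨y, hy⟩
  · have key : ∀ l : List (Fin n), l.countP (x ≤ ·) = l.count x := fun l => by
      refine List.countP_congr fun y _ => ?_
      simp only [decide_eq_true_eq, beq_iff_eq]
      exact ⟨fun h => le_antisymm (hx y) h, fun h => h.ge⟩
    rw [← key, ← key, h]
  · have := h x
    rw [countP_covBy hy, countP_covBy hy, h y] at this
    omega

theorem IsYamanouchi.exists_columns {w : List (Fin n)} (hw : IsYamanouchi w) :
    ∃ l, KnuthEquiv w (columns l) := by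
  induction w with
  | nil => exact ⟨[], .refl _⟩
  | cons x w ih =>
    obtain ⟨l, hl⟩ := ih hw.tail
    rcases exists_covBy_left x with hx | ⟨y, hy⟩
    · refine ⟨x :: l, ?_⟩
      have : columns (x :: l) = x :: columns l := by simp [columns, column_zero hx]
      exact this ▸ hl.cons x
    · have h1 := hw y x hy
      rw [eps_cons, if_pos rfl] at h1
      have h2 := phi_add_count (a := y) (b := x) w
      have h3 := List.perm_iff_count.1 hl.perm
      rw [h3, h3, count_columns, count_columns, countP_covBy hy] at h2
      -- As `x :: w` has no unmatched `x`, the letter `y` outnumbers `x` in `w`; the surplus is the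
      -- number of columns with top `y`. One of these moves to the front, where `x` extends it.
      have h4 : y ∈ l := List.count_pos_iff.1 (by omega)
      refine ⟨x :: l.erase y, ((hl.trans (columns_perm (List.perm_cons_erase h4))).cons x).trans ?_⟩
      exact .of_eq (by simp [columns, column_succ hy])

theorem IsYamanouchi.knuthEquiv {u v : List (Fin n)} (hu : IsYamanouchi u) (hv : IsYamanouchi v)
    (h : u.Perm v) : KnuthEquiv u v := by
  obtain ⟨l, hl⟩ := hu.exists_columns
  obtain ⟨l', hl'⟩ := hv.exists_columns
  exact hl.trans ((columns_perm (perm_of_columns_perm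
    (hl.perm.symm.trans (h.trans hl'.perm)))).trans hl'.symm)

/-! ### Co-mirroring and the crystal structure -/

/-- The co-mirror of a letter, as a list. -/
def mirrorLetter (x : Fin n) : List (Fin n) := (fullColumn n).filter (fun j => j ≠ x.rev)

/-- The co-mirror of a word, as a list. -/
def mirror (w : List (Fin n)) : List (Fin n) := w.flatMap mirrorLetter

theorem coMirror_ofList (w : List (Fin n)) :
    coMirror n (FreeMonoid.ofList w) = FreeMonoid.ofList (mirror w) := by
  induction w with
  | nil => exact map_one _
  | cons x w ih =>
    rw [FreeMonoid.ofList_cons, map_mul, ih]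
    rfl

theorem covBy_rev {a b : Fin n} (hab : a ⋖ b) : b.rev ⋖ a.rev := by
  refine ⟨Fin.rev_lt_rev.2 hab.lt, fun z h1 h2 => hab.2 (c := z.rev) ?_ ?_⟩
  · rwa [← Fin.rev_lt_rev, Fin.rev_rev]
  · rwa [← Fin.rev_lt_rev, Fin.rev_rev]

/-- Of the pair `b.rev`, `a.rev`, the co-mirror of `a` retains only `b.rev` and that of `b` only
`a.rev`. Every other co-mirror contains the adjacent matched pair `a.rev`, `b.rev`. -/
theorem mirrorLetter_crystal {a b : Fin n} (hab : a ⋖ b) (x : Fin n) :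
    phi b.rev a.rev (mirrorLetter x) = phi a b [x] ∧
    eps b.rev a.rev (mirrorLetter x) = eps a b [x] ∧
    raise b.rev a.rev (mirrorLetter x) = mirror (raise a b [x]) := by
  have hlt := hab.lt
  have hrev := covBy_rev hab
  obtain ⟨s, t, hst⟩ := exists_fullColumn_eq hrev
  have hd : (s ++ a.rev :: b.rev :: t).Nodup := hst ▸ (pairwise_fullColumn n).imp (fun h => h.ne')
  have hne := hrev.lt.ne
  have hne' := hrev.lt.ne'
  simp only [List.nodup_append, List.nodup_cons, List.mem_cons, not_or] at hd
  obtain ⟨-, ⟨⟨-, hat⟩, hbt, -⟩, hs⟩ := hd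
  have has : a.rev ∉ s := fun h => hs _ h _ (Or.inl rfl) rfl
  have hbs : b.rev ∉ s := fun h => hs _ h _ (Or.inr (Or.inl rfl)) rfl
  have fa : ∀ l : List (Fin n), a.rev ∉ l → l.filter (fun j => j ≠ a.rev) = l := fun l h =>
    List.filter_eq_self.2 fun z hz => by
      simpa using (fun h' => h (h' ▸ hz) : z ≠ a.rev)
  have fb : ∀ l : List (Fin n), b.rev ∉ l → l.filter (fun j => j ≠ b.rev) = l := fun l h =>
    List.filter_eq_self.2 fun z hz => by
      simpa using (fun h' => h (h' ▸ hz) : z ≠ b.rev)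
  have ma : mirrorLetter a = s ++ b.rev :: t := by
    rw [mirrorLetter, hst, List.filter_append, fa s has, List.filter_cons, List.filter_cons,
      fa t hat]
    simp [hne]
  have mb : mirrorLetter b = s ++ a.rev :: t := by
    rw [mirrorLetter, hst, List.filter_append, fb s hbs, List.filter_cons, List.filter_cons,
      fb t hbt]
    simp [hne']
  obtain ⟨ps, es⟩ := strings_of_not_mem hbs has
  obtain ⟨pt, et⟩ := strings_of_not_mem hbt hat
  have hm : ∀ y : Fin n, mirror [y] = mirrorLetter y := fun y => by simp [mirror]
  by_cases hxa : x = a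
  · subst hxa
    have : raise x b [x] = [x] := by simp [raise_cons, hlt.ne]
    rw [this, hm, ma]
    simp [phi_append hne, eps_append hne, raise_append hne, phi_cons, eps_cons, ps, es, pt, et,
      hne, hlt.ne, raise_cons, raise_eq_self et]
  · by_cases hxb : x = b
    · subst hxb
      have : raise a x [x] = [a] := by simp [raise_cons]
      rw [this, hm, ma, mb]
      simp [phi_append hne, eps_append hne, raise_append hne, phi_cons, eps_cons, ps, es, pt, et,
        hne', hlt.ne', raise_cons]
    · have : raise a b [x] = [x] := by simp [raise_cons, hxb]
      have hxa' : a.rev ≠ x.rev := fun h => hxa (Fin.rev_injective h).symm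
      have hxb' : b.rev ≠ x.rev := fun h => hxb (Fin.rev_injective h).symm
      have hms : mirrorLetter x = s.filter (fun j => j ≠ x.rev) ++
          a.rev :: b.rev :: t.filter (fun j => j ≠ x.rev) := by
        rw [mirrorLetter, hst, List.filter_append, List.filter_cons, List.filter_cons,
          if_pos (by simpa using hxa'), if_pos (by simpa using hxb')]
      obtain ⟨ps, es⟩ := strings_of_not_mem (fun h => hbs (List.mem_of_mem_filter h))
        (fun h => has (List.mem_of_mem_filter (p := fun j => decide (j ≠ x.rev)) h))
      obtain ⟨pt, et⟩ := strings_of_not_mem (fun h => hbt (List.mem_of_mem_filter h))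
        (fun h => hat (List.mem_of_mem_filter (p := fun j => decide (j ≠ x.rev)) h))
      have he : eps b.rev a.rev (mirrorLetter x) = 0 := by
        rw [hms, eps_append hne, es, eps_cons, eps_cons, phi_cons, pt, et]
        simp [hne]
      refine ⟨?_, ?_, ?_⟩
      · rw [hms, phi_append hne, ps, es, phi_cons, phi_cons, pt]
        simp [hne, hne', phi_cons, hxa]
      · rw [he]
        simp [eps_cons, hxb]
      · rw [this, hm, raise_eq_self he]

theorem mirror_crystal {a b : Fin n} (hab : a ⋖ b) (w : List (Fin n)) :
    phi b.rev a.rev (mirror w) = phi a b w ∧ eps b.rev a.rev (mirror w) = eps a b w ∧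
    raise b.rev a.rev (mirror w) = mirror (raise a b w) := by
  have hne : b.rev ≠ a.rev := fun h => hab.lt.ne' (Fin.rev_injective h)
  induction w with
  | nil => simp [mirror]
  | cons x w ih =>
    obtain ⟨h1, h2, h3⟩ := ih
    obtain ⟨l1, l2, l3⟩ := mirrorLetter_crystal hab x
    have e : mirror (x :: w) = mirrorLetter x ++ mirror w := rfl
    have e' : x :: w = [x] ++ w := rfl
    rw [e, e', phi_append hne, eps_append hne, raise_append hne, phi_append hab.lt.ne,
      eps_append hab.lt.ne, raise_append hab.lt.ne, h1, h2, h3, l1, l2, l3]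
    refine ⟨rfl, rfl, ?_⟩
    split_ifs
    · simp [mirror]
    · simp [mirror]

theorem isYamanouchi_mirror {w : List (Fin n)} : IsYamanouchi (mirror w) ↔ IsYamanouchi w := by
  constructor
  · intro h a b hab
    rw [← (mirror_crystal hab w).2.1]
    exact h _ _ (covBy_rev hab)
  · intro h a b hab
    have := (mirror_crystal (covBy_rev hab) w).2.1
    rw [Fin.rev_rev, Fin.rev_rev] at this
    rw [this]
    exact h _ _ (covBy_rev hab)

/-! ### Reduction to highest weight words -/

theorem KnuthEquiv.of_raise {α : Type*} [LinearOrder α] {a b : α} (hab : a ⋖ b) {u v : List α}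
    (hu : 0 < eps a b u) (hv : 0 < eps a b v) (h : KnuthEquiv (raise a b u) (raise a b v)) :
    KnuthEquiv u v := by
  have := (hab.crystalEquiv h).lower
  rwa [lower_raise hab.lt.ne hu, lower_raise hab.lt.ne hv] at this

/-- Termination measure for `raise_induction`. -/
theorem sum_raise_lt {a b : Fin n} (hab : a < b) {w : List (Fin n)} (h : 0 < eps a b w) :
    ((raise a b w).map Fin.val).sum < (w.map Fin.val).sum := by
  induction w with
  | nil => simp at h
  | cons x w ih =>
    rw [eps_cons] at h
    rw [raise_cons]
    by_cases hb : x = b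
    · simp only [hb, if_true] at h ⊢
      split_ifs with h'
      · simpa using hab
      · simpa using ih (by omega)
    · simp only [hb, if_false] at h ⊢
      simpa using ih (by omega)

/-- A relation on words may be checked after applying raising operators, and hence for highest
weight words only. -/
theorem raise_induction {P : List (Fin n) → List (Fin n) → Prop}
    (hraise : ∀ a b u v, a ⋖ b → 0 < eps a b u → P (raise a b u) (raise a b v) → P u v)
    (hyam : ∀ u v, IsYamanouchi u → P u v) (u v : List (Fin n)) : P u v := by
  induction hk : (u.map Fin.val).sum using Nat.strong_induction_on generalizing u v with
  | _ k ih =>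
    by_cases hu : IsYamanouchi u
    · exact hyam u v hu
    · simp only [IsYamanouchi, not_forall] at hu
      obtain ⟨a, b, hab, h⟩ := hu
      have h := Nat.pos_of_ne_zero h
      exact hraise a b u v hab h (ih _ (hk ▸ sum_raise_lt hab.lt h) _ _ rfl)

/-! ### Content of co-mirrors -/

theorem mirrorLetter_eq {x : Fin n} {s t : List (Fin n)} (hst : fullColumn n = s ++ x.rev :: t)
    (hs : ∀ y ∈ s, x.rev < y) (ht : ∀ y ∈ t, y < x.rev) : mirrorLetter x = s ++ t := by
  have hs' : s.filter (fun j => j ≠ x.rev) = s :=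
    List.filter_eq_self.2 fun z hz => by simpa using (hs z hz).ne'
  have ht' : t.filter (fun j => j ≠ x.rev) = t :=
    List.filter_eq_self.2 fun z hz => by simpa using (ht z hz).ne
  rw [mirrorLetter, hst, List.filter_append, hs', List.filter_cons, ht']
  simp

theorem mirrorLetter_perm (x : Fin n) : (x.rev :: mirrorLetter x).Perm (fullColumn n) := by
  obtain ⟨s, t, hst, hs, ht⟩ := exists_fullColumn_eq_append x.rev
  rw [mirrorLetter_eq hst hs ht, hst]
  exact List.perm_middle.symm

theorem count_mirror (x : Fin n) (w : List (Fin n)) :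
    (mirror w).count x + w.count x.rev = w.length := by
  induction w with
  | nil => rfl
  | cons y w ih =>
    have h := (mirrorLetter_perm y).count_eq x
    have e : mirror (y :: w) = mirrorLetter y ++ mirror w := rfl
    have h1 : (fullColumn n).count x = 1 := by
      rw [fullColumn, List.count_reverse]; simp
    rw [h1, List.count_cons] at h
    rw [e, List.count_append, List.count_cons, List.length_cons, ← ih]
    have : (y.rev == x) = (y == x.rev) := by
      rw [Bool.eq_iff_iff]; simp [Fin.rev_eq_iff]
    rw [this] at h
    omega

theorem length_mirror (w : List (Fin n)) : (mirror w).length + w.length = n * w.length := by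
  induction w with
  | nil => rfl
  | cons y w ih =>
    have h := (mirrorLetter_perm y).length_eq
    have h1 : (fullColumn n).length = n := by simp [fullColumn]
    have e : mirror (y :: w) = mirrorLetter y ++ mirror w := rfl
    rw [h1, List.length_cons] at h
    rw [e, List.length_append, List.length_cons, Nat.mul_add, ← ih]
    omega

theorem perm_mirror {u v : List (Fin n)} (h : u.Perm v) : (mirror u).Perm (mirror v) :=
  h.flatMap_right _

theorem perm_of_mirror_perm (hn : 2 ≤ n) {u v : List (Fin n)} (h : (mirror u).Perm (mirror v)) :
    u.Perm v := by
  have hl : u.length = v.length := by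
    have h1 := length_mirror u
    have h2 := length_mirror v
    rw [h.length_eq] at h1
    -- Here `m + 1` is `n - 1`, the length of each letter's co-mirror; being nonzero, it can be
    -- cancelled.
    obtain ⟨m, rfl⟩ := Nat.exists_eq_add_of_le' hn
    have : (m + 1) * u.length = (m + 1) * v.length := by nlinarith
    exact Nat.eq_of_mul_eq_mul_left (by omega) this
  rw [List.perm_iff_count] at h ⊢
  intro x
  have h1 := count_mirror x.rev u
  have h2 := count_mirror x.rev v
  rw [Fin.rev_rev] at h1 h2
  have := h x.rev
  omega

/-! ### Knuth equivalence against co-plactic equivalence -/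

theorem KnuthEquiv.mirror {u v : List (Fin n)} (h : KnuthEquiv u v) :
    KnuthEquiv (mirror u) (mirror v) := by
  revert h
  refine raise_induction (P := fun u v => KnuthEquiv u v →
    KnuthEquiv (Crystal.mirror u) (Crystal.mirror v))
    ?_ ?_ u v
  · intro a b u v hab hu ih h
    have hv : 0 < eps a b v := (hab.crystalEquiv h).eps_eq ▸ hu
    have ih := ih (hab.crystalEquiv h).raise
    rw [← (mirror_crystal hab u).2.2, ← (mirror_crystal hab v).2.2] at ih
    rw [← (mirror_crystal hab u).2.1] at hu
    rw [← (mirror_crystal hab v).2.1] at hv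
    exact of_raise (covBy_rev hab) hu hv ih
  · intro u v hu h
    exact (isYamanouchi_mirror.2 hu).knuthEquiv (isYamanouchi_mirror.2 (h.isYamanouchi hu))
      (perm_mirror h.perm)

theorem KnuthEquiv.of_mirror (hn : 2 ≤ n) {u v : List (Fin n)}
    (h : KnuthEquiv (Crystal.mirror u) (Crystal.mirror v)) : KnuthEquiv u v := by
  revert h
  refine raise_induction (P := fun u v => KnuthEquiv (Crystal.mirror u) (Crystal.mirror v) →
    KnuthEquiv u v)
    ?_ ?_ u v
  · intro a b u v hab hu ih h
    -- Equivalence of `u` and `v` is not yet known, so the equality of their `eps` is read off from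
    -- the co-mirrors.
    have hc := (covBy_rev hab).crystalEquiv h
    have hv := hc.eps_eq
    rw [(mirror_crystal hab u).2.1, (mirror_crystal hab v).2.1] at hv
    have hr := hc.raise
    rw [(mirror_crystal hab u).2.2, (mirror_crystal hab v).2.2] at hr
    exact of_raise hab hu (hv ▸ hu) (ih hr)
  · intro u v hu h
    exact hu.knuthEquiv (isYamanouchi_mirror.1 (h.isYamanouchi (isYamanouchi_mirror.2 hu)))
      (perm_of_mirror_perm hn h.perm)

/-! ### Lexicographic order of the co-mirrors -/

theorem mirrorLetter_lt {p q : Fin n} (h : p < q) : mirrorLetter p < mirrorLetter q := by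
  obtain ⟨s, t, hst, hs, ht⟩ := exists_fullColumn_eq_append p.rev
  have hqp : q.rev < p.rev := Fin.rev_lt_rev.2 h
  have hs' : s.filter (fun j => j ≠ q.rev) = s :=
    List.filter_eq_self.2 fun z hz => by simpa using (hqp.trans (hs z hz)).ne'
  have hq : q.rev ∈ t := by
    have := mem_fullColumn q.rev
    rw [hst, List.mem_append, List.mem_cons] at this
    rcases this with h' | h' | h'
    · exact absurd (hs _ h') hqp.not_gt
    · exact absurd h' hqp.ne
    · exact h'
  have e2 : mirrorLetter q = s ++ p.rev :: t.filter (fun j => j ≠ q.rev) := by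
    rw [mirrorLetter, hst, List.filter_append, hs', List.filter_cons]
    rw [if_pos (by simpa using hqp.ne')]
  rw [mirrorLetter_eq hst hs ht, e2]
  obtain _ | ⟨c, t⟩ := t
  · simp at hq
  -- The first disagreement is right after `s`, where the co-mirror of `q` still has `p.rev` and
  -- that of `p` has a smaller letter.
  · refine List.Lex.append_left _ ?_ s
    exact List.Lex.rel (ht c (by simp))

end Columns

end Crystal

theorem mainTheorem8 (n : ℕ) :
    -- the co-mirrors are strictly increasing in the lexicographic order of words
    (∀ p q : Fin n, p < q →
      FreeMonoid.toList (coMirrorLetter p) < FreeMonoid.toList (coMirrorLetter q)) ∧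
    -- so ordered, they satisfy the Knuth relations in the plactic monoid
    SatisfiesKnuthRelations (fun i : Fin n => placticClass n (coMirrorLetter i)) ∧
    -- Knuth equivalence implies co-plactic equivalence
    (∀ u v : FreeMonoid (Fin n), placticCon n u v → CoPlacticEquiv n u v) ∧
    -- the induced map is a homomorphism onto the submonoid generated by the co-mirrors,
    -- and an isomorphism as soon as `2 ≤ n`
    (∃ d : PlacticMonoid n →* coMirrorSubmonoid n,
      (∀ w : FreeMonoid (Fin n),
        (d (placticClass n w) : PlacticMonoid n) = placticClass n (coMirror n w)) ∧
      Function.Surjective d ∧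
      (2 ≤ n → ∃ e : PlacticMonoid n ≃* coMirrorSubmonoid n, e.toMonoidHom = d)) := by
  have hco : ∀ u v : FreeMonoid (Fin n), placticCon n u v → CoPlacticEquiv n u v := by
    intro u v h
    have h' : Crystal.KnuthEquiv u.toList v.toList := h
    have := h'.mirror
    unfold Crystal.KnuthEquiv at this
    rwa [← Crystal.coMirror_ofList, ← Crystal.coMirror_ofList] at this
  have hinj : 2 ≤ n → ∀ u v : FreeMonoid (Fin n), CoPlacticEquiv n u v → placticCon n u v := by
    intro hn u v h
    have h' : conGen KnuthRel (coMirror n (FreeMonoid.ofList u.toList))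
      (coMirror n (FreeMonoid.ofList v.toList)) := h
    rw [Crystal.coMirror_ofList, Crystal.coMirror_ofList] at h'
    exact Crystal.KnuthEquiv.of_mirror hn h'
  have hletter : ∀ i : Fin n, coMirror n (FreeMonoid.of i) = coMirrorLetter i := fun i =>
    FreeMonoid.lift_eval_of _ _
  have hclass : ∀ u v : FreeMonoid (Fin n), placticCon n u v →
      placticClass n (coMirror n u) = placticClass n (coMirror n v) := fun u v h =>
    (placticCon n).eq.2 (hco u v h)
  refine ⟨fun p q h => Crystal.mirrorLetter_lt h, ⟨?_, ?_⟩, hco, ?_⟩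
  -- The Knuth relations among the co-mirrors are images of those among the letters.
  · intro p q r h1 h2
    have := hclass _ _ (ConGen.Rel.of _ _ (KnuthRel.kn1 p q r h1 h2))
    simpa only [map_mul, hletter] using this
  · intro p q r h1 h2
    have := hclass _ _ (ConGen.Rel.of _ _ (KnuthRel.kn2 p q r h1 h2))
    simpa only [map_mul, hletter] using this
  · have hmem : ∀ w : FreeMonoid (Fin n),
        placticClass n (coMirror n w) ∈ coMirrorSubmonoid n := by
      intro w
      induction w using FreeMonoid.inductionOn' with
      | one => rw [map_one, map_one]; exact one_mem _
      | of_mul x w ih =>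
        rw [map_mul, map_mul, hletter]
        exact mul_mem (Submonoid.subset_closure ⟨x, rfl⟩) ih
    let f : FreeMonoid (Fin n) →* coMirrorSubmonoid n :=
      ((placticClass n).comp (coMirror n)).codRestrict _ hmem
    let d : PlacticMonoid n →* coMirrorSubmonoid n :=
      (placticCon n).lift f fun u v h => Subtype.ext (hclass u v h)
    have hd : ∀ w, (d (placticClass n w) : PlacticMonoid n) = placticClass n (coMirror n w) :=
      fun w => rfl
    have hsurj : Function.Surjective d := by
      rintro ⟨y, hy⟩
      induction hy using Submonoid.closure_induction with
      | mem y hy =>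
        obtain ⟨i, rfl⟩ := hy
        exact ⟨placticClass n (FreeMonoid.of i), Subtype.ext (by rw [hd, hletter])⟩
      | one => exact ⟨1, map_one d⟩
      | mul y z hy hz ihy ihz =>
        obtain ⟨y', hy'⟩ := ihy
        obtain ⟨z', hz'⟩ := ihz
        exact ⟨y' * z', by rw [map_mul, hy', hz']; rfl⟩
    refine ⟨d, hd, hsurj, fun hn => ⟨MulEquiv.ofBijective d ⟨?_, hsurj⟩, rfl⟩⟩
    intro x y h
    induction x using Con.induction_on with | _ u =>
    induction y using Con.induction_on with | _ v =>
    have h' := congrArg Subtype.val h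
    exact (placticCon n).eq.2 (hinj hn u v ((placticCon n).eq.1 h'))
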